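/- Consider the white noise model $dY(t)=f(t)\,dt+\frac1{\sqrt n}\,dW(t)$, $-\frac12\le t\le\frac12$, where $W$ is a standard Brownian motion and $n$ is a positive integer; an estimator is a measurable real-valued function $\hat T$ of the observed path $Y$ (started from $Y(-\frac12)=0$), and $E_f$ denotes expectation when the drift is $f$. Let $T$ be a linear functional on a linear space $D$ of square-integrable functions on $[-\frac12,\frac12]$, and for $\mathcal F,\mathcal G\subseteq D$ and $0\le\varepsilon\le\infty$ let $$\omega_+(\varepsilon,\mathcal F,\mathcal G)=\sup\{|Tg-Tf| : \|g-f\|_2\le\varepsilon,\ f\in\mathcal F,\ g\in\mathcal G\}\in[0,\infty],\qquad \omega(\varepsilon,\mathcal F)=\omega_+(\varepsilon,\mathcal F,\mathcal F)$$ be the between-class modulus and the usual modulus of continuity. **Theorem 1.** For every $c_*>0$ there is a constant $c>0$, depending only on $c_*$, such that the following holds. Let $D$ and $T$ be as above, and let $\mathcal F_1,\mathcal F_2\subseteq D$ satisfy $\mathcal F_1\cap\mathcal F_2\ne\emptyset$ and, for some $\varepsilon_0>0$, $\omega(\varepsilon,\mathcal F_1)\le\omega(\varepsilon,\mathcal F_2)$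 for all $0<\varepsilon\le\varepsilon_0$. Put $$\gamma_n=\max\Big\{e,\ \frac{\omega_+(1/\sqrt n,\mathcal F_1,\mathcal F_2)}{c_*\,\omega(1/\sqrt n,\mathcal F_1)}\Big\}.$$ Then for all sufficiently large $n$, every estimator $\hat T$ with $$\sup_{f\in\mathcal F_1}E_f(\hat T-Tf)^2\le c_*^2\,\omega^2\Big(\frac1{\sqrt n},\mathcal F_1\Big)$$ satisfies $$\sup_{f\in\mathcal F_2}E_f(\hat T-Tf)^2\ge c\Big\{\omega_+^2\Big(\sqrt{\frac{\ln\gamma_n}{n}},\mathcal F_1,\mathcal F_2\Big)+\omega^2\Big(\frac1{\sqrt n},\mathcal F_2\Big)\Big\}.$$ Risks and moduli take values in $[0,\infty]$; in degenerate cases $a/0=\infty$ for $0<a\le\infty$, $0/0=\infty/\infty=0$, and $\ln\infty=\infty$. -/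

import Mathlib

open MeasureTheory ProbabilityTheory
open scoped NNReal ENNReal

noncomputable section

namespace WhiteNoise

/-- The observation interval `[-1/2, 1/2]`. -/
abbrev ObsInterval : Type := Set.Icc (-(1 / 2) : ℝ) (1 / 2)

/-- Lebesgue measure on the observation interval. -/
def lebesgue : Measure ObsInterval := Measure.comap Subtype.val volume

/-- The time elapsed since the left end point of the observation interval. -/
def elapsed (t : ObsInterval) : ℝ≥0 :=
  ⟨(t : ℝ) + 1 / 2, by have h := t.2.1; linarith⟩

/-- The path observed in the white noise model `dY(t) = f(t) dt + n^{-1/2} dW(t)` on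
`[-1/2, 1/2]`, started from `Y(-1/2) = 0`:
`Y(t) = ∫_{-1/2}^t f(s) ds + n^{-1/2} W(t + 1/2)`, with `W` a standard Brownian motion. -/
def observedPath {Ω : Type*} (W : ℝ≥0 → Ω → ℝ) (n : ℕ) (f : ObsInterval → ℝ) (ω : Ω) :
    ObsInterval → ℝ :=
  fun t => (∫ s in Set.Iic t, f s ∂lebesgue) + (1 / √(n : ℝ)) * W (elapsed t) ω

/-- The mean squared error `E_f (That - T f)^2` of the estimator `That`, a function of the
observed path, when the drift is `f` and the value to be estimated is `Tf`. -/
def risk {Ω : Type*} [MeasurableSpace Ω] (P : Measure Ω) (W : ℝ≥0 → Ω → ℝ) (n : ℕ)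
    (That : (ObsInterval → ℝ) → ℝ) (f : ObsInterval → ℝ) (Tf : ℝ) : ℝ≥0∞ :=
  ∫⁻ ω, ENNReal.ofReal ((That (observedPath W n f ω) - Tf) ^ 2) ∂P

variable {D : Submodule ℝ (ObsInterval → ℝ)}

/-- The maximum mean squared error over the parameter space `F`. -/
def maxRisk {Ω : Type*} [MeasurableSpace Ω] (P : Measure Ω) (W : ℝ≥0 → Ω → ℝ) (n : ℕ)
    (That : (ObsInterval → ℝ) → ℝ) (T : D →ₗ[ℝ] ℝ) (F : Set D) : ℝ≥0∞ :=
  ⨆ f ∈ F, risk P W n That (f : ObsInterval → ℝ) (T f)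

/-- The between-class modulus of continuity
`ω₊(ε, F, G) = sup {|T g - T f| : ‖g - f‖₂ ≤ ε, f ∈ F, g ∈ G}`, with values in `[0, ∞]`. -/
def betweenModulus (T : D →ₗ[ℝ] ℝ) (F G : Set D) (ε : ℝ≥0∞) : ℝ≥0∞ :=
  ⨆ f ∈ F, ⨆ g ∈ G,
    ⨆ _ : eLpNorm ((g : ObsInterval → ℝ) - (f : ObsInterval → ℝ)) 2 lebesgue ≤ ε,
      ENNReal.ofReal |T g - T f|

/-- The usual modulus of continuity
`ω(ε, F) = sup {|T g - T f| : ‖g - f‖₂ ≤ ε, f ∈ F, g ∈ F}`. -/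
def modulus (T : D →ₗ[ℝ] ℝ) (F : Set D) (ε : ℝ≥0∞) : ℝ≥0∞ :=
  betweenModulus T F F ε

/-- The noise level `1 / √n`. -/
def noiseLevel (n : ℕ) : ℝ≥0∞ := ENNReal.ofReal (1 / √(n : ℝ))

/-- `γ_n = max {e, ω₊(1/√n, F₁, F₂) / (c⋆ ω(1/√n, F₁))}` in `[0, ∞]`, where `a / 0 = ∞` for
`a > 0` and `0 / 0 = ∞ / ∞ = 0`. -/
def gammaFactor (T : D →ₗ[ℝ] ℝ) (F₁ F₂ : Set D) (cstar : ℝ) (n : ℕ) : ℝ≥0∞ :=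
  max (ENNReal.ofReal (Real.exp 1))
    (betweenModulus T F₁ F₂ (noiseLevel n) /
      (ENNReal.ofReal cstar * modulus T F₁ (noiseLevel n)))

/-- `√(ln γ / n)` for `γ ≥ 1`, with value `∞` at `γ = ∞`. -/
def logNoiseLevel (γ : ℝ≥0∞) (n : ℕ) : ℝ≥0∞ :=
  ((ENNReal.log γ).toENNReal / (n : ℝ≥0∞)) ^ (1 / 2 : ℝ)

end WhiteNoise

end

/-!
The argument is a constrained two-point bound. If an estimator has small risk at `f`, then for any
other drift `g` its risk at `g` is large:
`|T g - T f| ≤ exp (n ‖g - f‖₂² / 2) √(risk at f) + √(risk at g)` (`ofReal_abs_sub_le_risk`).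
The exponential is a bound for the `L²` norm of the density of the law of the path under `g` with
respect to its law under `f`; for `‖g - f‖₂ ≤ √(ln γ / n)` it is `√γ`.

The bound on the density (`lintegral_observedPath_le`) comes from a splitting of the Brownian
motion rather than from a general Cameron–Martin theorem. The map `1_{(-∞, t]} ↦ W_t` preserves
inner products between `L²` of the interval and `L²(P)`, so `h = g - f` has a counterpart `Z` in
the closed span of `W` (`exists_mem_closure_span_inner_eq`), which consists of Gaussian variables
(`isGaussianProcess_of_mem_closure_span`). Removing from `W` its component along the normalised
variable `ξ = Z / ‖Z‖` leaves a process independent of `ξ`, and passing from drift `f` to drift `g`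
replaces `ξ` by `ξ + √n ‖Z‖` and changes nothing else (`exists_gaussian_coordinate`). Only the
density of a translated standard normal variable on the line is needed
(`lintegral_gaussianReal_prod_add_le`).

Write `s₁`, `s₂` for the roots of the maximum risks over `F₁` and `F₂`, and `ω₁`, `ω₂`, `ω₊` for
the moduli at `1 / √n`. The two-point bound gives `ω₂ ≤ (√e + 1) s₂` and `ω₊ ≤ √e s₁ + s₂`. Since
`s₁ ≤ c⋆ ω₁ ≤ c⋆ ω₂`, both are at most a constant times `s₂`. At distance `√(ln γ / n)` it gives
`√γ s₁ + s₂ ≤ γ c⋆ ω₁ + s₂`, and `γ c⋆ ω₁ ≤ e c⋆ ω₁ + ω₊` by the definition of `γ`, so this is again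
at most a constant times `s₂`. If `γ = ∞`, then either `s₁ = 0`, and the bound holds at every
distance, or `ω₊ = ∞`, and `s₂ = ∞`.
-/

namespace WhiteNoise

/-! ### Shifting a Gaussian coordinate -/

lemma gaussianReal_one_eq_withDensity (a : ℝ) :
    gaussianReal a 1 = (gaussianReal 0 1).withDensity
      (fun x => ENNReal.ofReal (Real.exp (a * x - a ^ 2 / 2))) := by
  rw [gaussianReal_of_var_ne_zero _ one_ne_zero, gaussianReal_of_var_ne_zero _ one_ne_zero,
    ← withDensity_mul _ (measurable_gaussianPDF 0 1) (by fun_prop)]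
  congr 1
  ext x
  rw [Pi.mul_apply, gaussianPDF, gaussianPDF,
    ← ENNReal.ofReal_mul (gaussianPDFReal_nonneg _ _ _)]
  simp only [gaussianPDFReal, NNReal.coe_one, mul_one, mul_assoc, ← Real.exp_add]
  congr 3
  ring

/-- The second moment of the density of `N(a, 1)` with respect to `N(0, 1)`. -/
lemma lintegral_sq_exp_gaussianReal (a : ℝ) :
    ∫⁻ x, ENNReal.ofReal (Real.exp (a * x - a ^ 2 / 2)) ^ 2 ∂(gaussianReal 0 1) =
      ENNReal.ofReal (Real.exp (a ^ 2)) := by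
  have h : ∀ x : ℝ, ENNReal.ofReal (Real.exp (a * x - a ^ 2 / 2)) ^ 2 =
      ENNReal.ofReal (Real.exp (2 * a * x)) * ENNReal.ofReal (Real.exp (-a ^ 2)) := by
    intro x
    rw [← ENNReal.ofReal_pow (Real.exp_pos _).le, ← ENNReal.ofReal_mul (Real.exp_pos _).le,
      ← Real.exp_add, ← Real.exp_nat_mul]
    congr 2
    push_cast
    ring
  have hm := congrFun (mgf_fun_id_gaussianReal (μ := 0) (v := 1)) (2 * a)
  rw [mgf] at hm
  simp_rw [h]
  rw [lintegral_mul_const _ (by fun_prop), ← ofReal_integral_eq_lintegral_ofReal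
    (integrable_exp_mul_gaussianReal _) (Filter.Eventually.of_forall fun _ => (Real.exp_pos _).le),
    hm, ← ENNReal.ofReal_mul (Real.exp_pos _).le, ← Real.exp_add]
  congr 2
  push_cast
  ring

/-- Translating the Gaussian coordinate by `a` multiplies the density by one whose `L²` norm is
`exp (a² / 2)`; the bound is the Cauchy–Schwarz inequality. -/
lemma lintegral_gaussianReal_prod_add_le {E : Type*} [MeasurableSpace E] (ρ : Measure E)
    [IsProbabilityMeasure ρ] (a : ℝ) (φ : ℝ × E → ℝ≥0∞) (hφ : Measurable φ) :
    ∫⁻ p, φ (p.1 + a, p.2) ∂((gaussianReal 0 1).prod ρ) ≤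
      ENNReal.ofReal (Real.exp (a ^ 2 / 2)) *
        (∫⁻ p, φ p ^ 2 ∂((gaussianReal 0 1).prod ρ)) ^ (1 / 2 : ℝ) := by
  set L : ℝ → ℝ≥0∞ := fun x => ENNReal.ofReal (Real.exp (a * x - a ^ 2 / 2)) with hL
  have hLm : Measurable L := by fun_prop
  have hshift : ∀ r, ∫⁻ x, φ (x + a, r) ∂(gaussianReal 0 1) =
      ∫⁻ x, L x * φ (x, r) ∂(gaussianReal 0 1) := by
    intro r
    have hφr : Measurable fun x => φ (x, r) := by fun_prop
    have h := lintegral_map (μ := gaussianReal 0 1) (g := fun x => x + a) hφr (by fun_prop)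
    rw [gaussianReal_map_add_const, zero_add, gaussianReal_one_eq_withDensity,
      lintegral_withDensity_eq_lintegral_mul _ (by fun_prop) hφr] at h
    exact h.symm
  have h1 : ∫⁻ p, φ (p.1 + a, p.2) ∂((gaussianReal 0 1).prod ρ) =
      ∫⁻ p, (fun p : ℝ × E => L p.1) p * φ p ∂((gaussianReal 0 1).prod ρ) := by
    rw [lintegral_prod_symm' _ (by fun_prop), lintegral_prod_symm' _ (by fun_prop)]
    exact lintegral_congr hshift
  have h2 : ∫⁻ p, L p.1 ^ (2 : ℝ) ∂((gaussianReal 0 1).prod ρ) =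
      ENNReal.ofReal (Real.exp (a ^ 2)) := by
    rw [lintegral_prod_symm' _ (by fun_prop)]
    simp only [ENNReal.rpow_two, hL, lintegral_sq_exp_gaussianReal, lintegral_const, measure_univ,
      mul_one]
  have h3 := ENNReal.lintegral_mul_le_Lp_mul_Lq ((gaussianReal 0 1).prod ρ)
    Real.HolderConjugate.two_two (f := fun p : ℝ × E => L p.1) (g := φ)
    (by fun_prop) hφ.aemeasurable
  rw [h1]
  refine h3.trans_eq ?_
  rw [h2, ENNReal.ofReal_rpow_of_pos (Real.exp_pos _), ← Real.exp_mul]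
  simp only [ENNReal.rpow_two]
  congr 3
  ring

/-! ### Transport between Hilbert spaces with equal Gram matrices -/

/-- The isometry `a i ↦ b i` between closed spans carries the projection of `h` onto the span of
the `b i` to a vector `z` in the closed span of the `a i`. -/
lemma exists_mem_closure_span_inner_eq {ι E F : Type*} [NormedAddCommGroup E]
    [InnerProductSpace ℝ E] [CompleteSpace E] [NormedAddCommGroup F] [InnerProductSpace ℝ F]
    [CompleteSpace F] (a : ι → E) (b : ι → F)
    (hab : ∀ i j, inner ℝ (a i) (a j) = inner ℝ (b i) (b j)) (h : F) :
    ∃ z ∈ (Submodule.span ℝ (Set.range a)).topologicalClosure,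
      (∀ i, inner ℝ (a i) z = inner ℝ (b i) h) ∧ ‖z‖ ≤ ‖h‖ := by
  set A := Finsupp.linearCombination ℝ a
  set B := Finsupp.linearCombination ℝ b
  have hin : ∀ u v, inner ℝ (A u) (A v) = inner ℝ (B u) (B v) := by
    intro u v
    simp only [A, B, Finsupp.linearCombination_apply, Finsupp.sum, sum_inner, inner_sum,
      real_inner_smul_left, real_inner_smul_right, hab]
  have hnorm : ∀ u, ‖A u‖ = ‖B u‖ := by
    intro u
    have := hin u u
    simp only [real_inner_self_eq_norm_sq] at this
    exact (sq_eq_sq₀ (norm_nonneg _) (norm_nonneg _)).1 this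
  set K := (Submodule.span ℝ (Set.range b)).topologicalClosure
  have : CompleteSpace K :=
    (Submodule.isClosed_topologicalClosure _).completeSpace_coe
  set p : F := K.starProjection h
  have hpK : p ∈ K := K.starProjection_apply_mem h
  have hpb : ∀ i, inner ℝ (b i) p = inner ℝ (b i) h := by
    intro i
    have hbi : b i ∈ K := Submodule.le_topologicalClosure _ (Submodule.subset_span ⟨i, rfl⟩)
    have h0 := K.starProjection_inner_eq_zero h (b i) hbi
    rw [inner_sub_left, sub_eq_zero] at h0
    rw [real_inner_comm, real_inner_comm h]
    exact h0.symm
  have hpn : ‖p‖ ≤ ‖h‖ := K.norm_starProjection_apply_le h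
  have hrB : (Submodule.span ℝ (Set.range b) : Set F) = Set.range B := by
    rw [← LinearMap.coe_range, Finsupp.range_linearCombination]
  have hpc : p ∈ closure (Set.range B) := by
    rw [← hrB, ← Submodule.topologicalClosure_coe]
    exact hpK
  obtain ⟨x, hx, hxp⟩ := mem_closure_iff_seq_limit.1 hpc
  choose u hu using hx
  have hBu : Filter.Tendsto (fun m => B (u m)) Filter.atTop (nhds p) := by simpa [hu] using hxp
  have hcau : CauchySeq (fun m => A (u m)) := by
    have hc := hBu.cauchySeq
    rw [Metric.cauchySeq_iff] at hc ⊢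
    simpa only [dist_eq_norm, ← map_sub, hnorm] using hc
  obtain ⟨z, hz⟩ := cauchySeq_tendsto_of_complete hcau
  have hA1 : ∀ i, A (Finsupp.single i 1) = a i := by simp [A]
  have hB1 : ∀ i, B (Finsupp.single i 1) = b i := by simp [B]
  refine ⟨z, ?_, fun i => ?_, ?_⟩
  · refine mem_closure_of_tendsto hz (Filter.Eventually.of_forall fun m => ?_)
    have : A (u m) ∈ LinearMap.range A := ⟨_, rfl⟩
    rwa [Finsupp.range_linearCombination] at this
  · have h1 : Filter.Tendsto (fun m => inner ℝ (a i) (A (u m))) Filter.atTop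
        (nhds (inner ℝ (a i) z)) := tendsto_const_nhds.inner hz
    have h2 : Filter.Tendsto (fun m => inner ℝ (b i) (B (u m))) Filter.atTop
        (nhds (inner ℝ (b i) p)) := tendsto_const_nhds.inner hBu
    rw [← hpb]
    refine tendsto_nhds_unique h1 (h2.congr fun m => ?_)
    rw [← hA1, ← hB1, hin]
  · have h1 := hz.norm
    simp only [hnorm] at h1
    exact (tendsto_nhds_unique h1 hBu.norm).trans_le hpn

/-! ### The Gaussian Hilbert space of a Gaussian process -/

section GaussianHilbertSpace

variable {Ω : Type*} [MeasurableSpace Ω] {P : Measure Ω}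

lemma norm_cexp_mul_I_sub_le (x y : ℝ) :
    ‖Complex.exp (x * Complex.I) - Complex.exp (y * Complex.I)‖ ≤ |x - y| := by
  have h : Complex.exp (x * Complex.I) - Complex.exp (y * Complex.I) =
      Complex.exp (y * Complex.I) * (Complex.exp (Complex.I * ((x - y : ℝ) : ℂ)) - 1) := by
    rw [mul_sub, ← Complex.exp_add, mul_one]
    congr 2
    push_cast
    ring
  rw [h, norm_mul, Complex.norm_exp_ofReal_mul_I, one_mul]
  exact Real.norm_exp_I_mul_ofReal_sub_one_le

lemma continuous_integral_cexp_mul_I [IsProbabilityMeasure P] :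
    Continuous fun z : Lp ℝ 2 P => ∫ ω, Complex.exp ((z ω : ℝ) * Complex.I) ∂P := by
  refine LipschitzWith.continuous (K := 1) (LipschitzWith.of_dist_le_mul fun x y => ?_)
  have hint : ∀ z : Lp ℝ 2 P,
      Integrable (fun ω => Complex.exp ((z ω : ℝ) * Complex.I)) P := by
    intro z
    refine Integrable.of_bound (C := 1) ?_ (Filter.Eventually.of_forall fun ω => ?_)
    · have := (Lp.aestronglyMeasurable z).aemeasurable
      exact AEMeasurable.aestronglyMeasurable (by fun_prop)
    · rw [Complex.norm_exp_ofReal_mul_I]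
  have hxy : MemLp (fun ω => x ω - y ω) 2 P := (Lp.memLp x).sub (Lp.memLp y)
  rw [NNReal.coe_one, one_mul, dist_eq_norm, dist_eq_norm, ← integral_sub (hint x) (hint y)]
  calc ‖∫ ω, (Complex.exp ((x ω : ℝ) * Complex.I) - Complex.exp ((y ω : ℝ) * Complex.I)) ∂P‖
      ≤ ∫ ω, |x ω - y ω| ∂P :=
        norm_integral_le_of_norm_le (hxy.integrable one_le_two).abs
          (Filter.Eventually.of_forall fun ω => norm_cexp_mul_I_sub_le _ _)
    _ = (eLpNorm (fun ω => x ω - y ω) 1 P).toReal := by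
        rw [eLpNorm_one_eq_lintegral_enorm, ← integral_norm_eq_lintegral_enorm hxy.1]
        rfl
    _ ≤ (eLpNorm (fun ω => x ω - y ω) 2 P).toReal :=
        ENNReal.toReal_mono hxy.2.ne (eLpNorm_le_eLpNorm_of_exponent_le one_le_two hxy.1)
    _ = ‖x - y‖ := by
        rw [Lp.norm_def, eLpNorm_congr_ae (Lp.coeFn_sub x y)]
        rfl

lemma integral_sq_eq_norm_sq (z : Lp ℝ 2 P) : ∫ ω, z ω ^ 2 ∂P = ‖z‖ ^ 2 := by
  rw [← real_inner_self_eq_norm_sq, L2.inner_def]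
  exact integral_congr_ae (Filter.Eventually.of_forall fun ω => by simp [sq])

/-- The characteristic function of a centred Gaussian element of `L²`, at `1`. -/
lemma integral_cexp_mul_I_of_hasGaussianLaw (z : Lp ℝ 2 P) (hz : HasGaussianLaw z P)
    (h0 : ∫ ω, z ω ∂P = 0) :
    ∫ ω, Complex.exp ((z ω : ℝ) * Complex.I) ∂P = Complex.exp (-(‖z‖ ^ 2 : ℝ) / 2) := by
  have hP := hz.isProbabilityMeasure
  have h := hz.charFun_map_eq 1
  rw [charFun_apply_real, integral_map hz.aemeasurable
    (AEMeasurable.aestronglyMeasurable (by fun_prop))] at h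
  have hv : Var[z; P] = ‖z‖ ^ 2 := by
    rw [variance_of_integral_eq_zero hz.aemeasurable h0]
    exact integral_sq_eq_norm_sq z
  simp only [Complex.ofReal_one, one_mul, RCLike.inner_apply, conj_trivial, mul_one] at h
  rw [h, h0, hv]
  simp [neg_div]

/-- Limits in `L²` of linear combinations of a centred Gaussian process are centred Gaussian:
the identity `E exp (i z) = exp (-‖z‖² / 2)` is closed in `L²`, and on a subspace it determines
the characteristic functions. -/
lemma map_eq_gaussianReal_of_mem_closure_span {T : Type*} {X : T → Ω → ℝ}
    (hX : IsGaussianProcess X P) (h0 : ∀ t, ∫ ω, X t ω ∂P = 0) (x : T → Lp ℝ 2 P)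
    (hx : ∀ t, x t =ᵐ[P] X t) {z : Lp ℝ 2 P}
    (hz : z ∈ (Submodule.span ℝ (Set.range x)).topologicalClosure) :
    P.map z = gaussianReal 0 (‖z‖₊ ^ 2) := by
  classical
  have hP := hX.isProbabilityMeasure
  have hspan : ∀ w ∈ Submodule.span ℝ (Set.range x),
      ∫ ω, Complex.exp ((w ω : ℝ) * Complex.I) ∂P = Complex.exp (-(‖w‖ ^ 2 : ℝ) / 2) := by
    intro w hw
    obtain ⟨c, rfl⟩ := (Finsupp.mem_span_range_iff_exists_finsupp).1 hw
    have hae : (∑ i ∈ c.support, c i • x i : Lp ℝ 2 P) =ᵐ[P]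
        ∑ i ∈ c.support, fun ω => c i • X i ω := by
      refine (Lp.coeFn_finsetSum _ _).trans ?_
      have : ∀ᵐ ω ∂P, ∀ i ∈ c.support, (c i • x i : Lp ℝ 2 P) ω = c i • X i ω := by
        refine (ae_ball_iff c.support.countable_toSet).2 fun i _ => ?_
        filter_upwards [Lp.coeFn_smul (c i) (x i), hx i] with ω h1 h2
        rw [h1, Pi.smul_apply, h2]
      filter_upwards [this] with ω hω
      simp only [Finset.sum_apply]
      exact Finset.sum_congr rfl hω
    have hXc := hX.smul c
    refine integral_cexp_mul_I_of_hasGaussianLaw _ ?_ ?_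
    · exact (hXc.hasGaussianLaw_sum (I := c.support)).congr hae.symm
    · rw [Finsupp.sum, integral_congr_ae hae]
      simp only [Finset.sum_apply]
      rw [integral_finsetSum _ fun i _ => (hXc.hasGaussianLaw_eval i).integrable]
      exact Finset.sum_eq_zero fun i _ => by rw [integral_smul, h0, smul_zero]
  have hclosed : IsClosed {w : Lp ℝ 2 P |
      ∫ ω, Complex.exp ((w ω : ℝ) * Complex.I) ∂P = Complex.exp (-(‖w‖ ^ 2 : ℝ) / 2)} :=
    isClosed_eq continuous_integral_cexp_mul_I (by fun_prop)
  have hcl : ∀ w ∈ (Submodule.span ℝ (Set.range x)).topologicalClosure,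
      ∫ ω, Complex.exp ((w ω : ℝ) * Complex.I) ∂P = Complex.exp (-(‖w‖ ^ 2 : ℝ) / 2) :=
    fun w hw => closure_minimal hspan hclosed hw
  have hzm := (Lp.aestronglyMeasurable z).aemeasurable
  have := Measure.isProbabilityMeasure_map hzm
  refine Measure.ext_of_charFun (funext fun t => ?_)
  rw [charFun_gaussianReal, charFun_apply_real, integral_map hzm
    (AEMeasurable.aestronglyMeasurable (by fun_prop))]
  have h := hcl (t • z) (Submodule.smul_mem _ t hz)
  rw [norm_smul, mul_pow] at h
  calc ∫ ω, Complex.exp ((t : ℂ) * (z ω : ℝ) * Complex.I) ∂P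
      = ∫ ω, Complex.exp (((t • z : Lp ℝ 2 P) ω : ℝ) * Complex.I) ∂P := by
        refine integral_congr_ae ?_
        filter_upwards [Lp.coeFn_smul t z] with ω hω
        rw [hω]
        simp
    _ = _ := by
        rw [h]
        congr 1
        simp only [Real.norm_eq_abs, sq_abs]
        push_cast
        ring

/-- Any family in the closed span of a centred Gaussian process is a Gaussian process. -/
lemma isGaussianProcess_of_mem_closure_span {T S : Type*} {X : T → Ω → ℝ}
    (hX : IsGaussianProcess X P) (h0 : ∀ t, ∫ ω, X t ω ∂P = 0) (x : T → Lp ℝ 2 P)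
    (hx : ∀ t, x t =ᵐ[P] X t) (y : S → Lp ℝ 2 P)
    (hy : ∀ s, y s ∈ (Submodule.span ℝ (Set.range x)).topologicalClosure) :
    IsGaussianProcess (fun s => (y s : Ω → ℝ)) P := by
  classical
  refine ⟨fun I => ⟨isGaussian_of_map_eq_gaussianReal fun L => ?_⟩⟩
  have hym : ∀ s, AEMeasurable (y s) P := fun s => (Lp.aestronglyMeasurable (y s)).aemeasurable
  set w : Lp ℝ 2 P := ∑ i : I, L (Pi.single i 1) • y i with hw
  have hwK : w ∈ (Submodule.span ℝ (Set.range x)).topologicalClosure :=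
    Submodule.sum_mem _ fun i _ => Submodule.smul_mem _ _ (hy i)
  refine ⟨0, ‖w‖₊ ^ 2, ?_⟩
  rw [← map_eq_gaussianReal_of_mem_closure_span hX h0 x hx hwK,
    AEMeasurable.map_map_of_aemeasurable (by fun_prop)
      (aemeasurable_pi_lambda (fun ω => I.restrict fun s => y s ω) fun i => hym i)]
  refine Measure.map_congr ?_
  have h1 : ∀ᵐ ω ∂P, ∀ i : I, (L (Pi.single i 1) • y i : Lp ℝ 2 P) ω =
      L (Pi.single i 1) • y i ω := ae_all_iff.2 fun i => Lp.coeFn_smul _ _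
  filter_upwards [h1, Lp.coeFn_finsetSum Finset.univ fun i : I => L (Pi.single i 1) • y i]
    with ω h2 h3
  rw [hw, h3, Function.comp_apply, ← L.sum_comp_single]
  simp only [Finset.sum_apply, h2]
  refine Finset.sum_congr rfl fun i _ => ?_
  rw [ContinuousLinearMap.comp_apply, ContinuousLinearMap.single_apply, smul_eq_mul, mul_comm,
    ← smul_eq_mul, ← map_smul, ← Pi.single_smul, smul_eq_mul, mul_one]
  rfl

end GaussianHilbertSpace

/-! ### Change of drift in the white noise model -/

instance isFiniteMeasure_lebesgue : IsFiniteMeasure lebesgue := by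
  refine ⟨?_⟩
  rw [lebesgue, comap_subtype_coe_apply measurableSet_Icc, Set.image_univ, Subtype.range_val]
  exact measure_Icc_lt_top

lemma coe_elapsed (t : ObsInterval) : (elapsed t : ℝ) = t + 1 / 2 := rfl

lemma lebesgue_real_Iic (t : ObsInterval) : lebesgue.real (Set.Iic t) = elapsed t := by
  have h : (Subtype.val '' Set.Iic t : Set ℝ) = Set.Icc (-(1 / 2)) (t : ℝ) := by
    ext x
    constructor
    · rintro ⟨s, hs, rfl⟩
      exact ⟨s.2.1, hs⟩
    · rintro ⟨h1, h2⟩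
      exact ⟨⟨x, h1, h2.trans t.2.2⟩, h2, rfl⟩
  rw [measureReal_def, lebesgue, comap_subtype_coe_apply measurableSet_Icc, h, Real.volume_Icc,
    ENNReal.toReal_ofReal (by linarith [t.2.1])]
  rw [coe_elapsed]
  ring

lemma elapsed_monotone : Monotone elapsed := by
  intro s t h
  have h' : (s : ℝ) ≤ t := h
  rw [← NNReal.coe_le_coe, coe_elapsed, coe_elapsed]
  linarith

lemma measurable_observedPath {Ω : Type*} [MeasurableSpace Ω] {W : ℝ≥0 → Ω → ℝ}
    (hWm : ∀ t, Measurable (W t)) (n : ℕ) (f : ObsInterval → ℝ) :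
    Measurable (observedPath W n f) :=
  measurable_pi_lambda _ fun t => by
    have := hWm (elapsed t)
    unfold observedPath
    fun_prop

lemma lintegral_le_lintegral_sq_rpow {Ω : Type*} [MeasurableSpace Ω] {P : Measure Ω}
    [IsProbabilityMeasure P] {φ : Ω → ℝ≥0∞} (hφ : AEMeasurable φ P) :
    ∫⁻ ω, φ ω ∂P ≤ (∫⁻ ω, φ ω ^ 2 ∂P) ^ (1 / 2 : ℝ) := by
  simpa using ENNReal.lintegral_mul_le_Lp_mul_Lq P Real.HolderConjugate.two_two hφ
    (aemeasurable_const (b := (1 : ℝ≥0∞)))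

/-- Changing the drift from `f` to `f + h` translates one Gaussian coordinate of the noise.
There are a Gaussian variable `ξ`, a process `R` independent of it and a function `u` on the
observation interval with `W = R + u ξ` and `∫_{-1/2}^t h = d u(t)`, where `d ≤ ‖h‖₂`.
The primitive of `h` must not vanish identically, as `ξ` is a normalised variable. -/
lemma exists_gaussian_coordinate {Ω : Type*} [MeasurableSpace Ω] {P : Measure Ω}
    {W : ℝ≥0 → Ω → ℝ} (hWm : ∀ t, Measurable (W t)) (hW : IsBrownianReal W P)
    (h : ObsInterval → ℝ) (hh : MemLp h 2 lebesgue)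
    (h0 : ∃ t : ObsInterval, ∫ s in Set.Iic t, h s ∂lebesgue ≠ 0) :
    ∃ (ξ : Ω → ℝ) (R : Ω → ObsInterval → ℝ) (u : ObsInterval → ℝ) (d : ℝ),
      Measurable ξ ∧ Measurable R ∧ P.map ξ = gaussianReal 0 1 ∧ IndepFun ξ R P ∧
      (∀ ω t, W (elapsed t) ω = R ω t + u t * ξ ω) ∧
      (∀ t, ∫ s in Set.Iic t, h s ∂lebesgue = d * u t) ∧
      0 ≤ d ∧ d ≤ (eLpNorm h 2 lebesgue).toReal := by
  have hG : IsGaussianProcess (fun t : ObsInterval => W (elapsed t)) P :=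
    hW.isGaussianProcess.comp_right elapsed
  have hP := hG.isProbabilityMeasure
  have hG0 : ∀ t : ObsInterval, ∫ ω, W (elapsed t) ω ∂P = 0 := fun t => hW.integral_eval _
  have hG2 : ∀ t : ObsInterval, MemLp (W (elapsed t)) 2 P :=
    fun t => (hG.hasGaussianLaw_eval t).memLp_two
  set a : ObsInterval → Lp ℝ 2 P := fun t => (hG2 t).toLp _
  have haW : ∀ t, a t =ᵐ[P] W (elapsed t) := fun t => (hG2 t).coeFn_toLp
  set b : ObsInterval → Lp ℝ 2 lebesgue := fun t =>
    indicatorConstLp 2 (measurableSet_Iic (a := t)) (measure_ne_top _ _) 1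
  have hab : ∀ s t, inner ℝ (a s) (a t) = inner ℝ (b s) (b t) := by
    intro s t
    have h1 : inner ℝ (b s) (b t) = lebesgue.real (Set.Iic s ∩ Set.Iic t) :=
      L2.real_inner_indicatorConstLp_one_indicatorConstLp_one _ _
    have h2 : inner ℝ (a s) (a t) = ∫ ω, W (elapsed s) ω * W (elapsed t) ω ∂P := by
      rw [L2.inner_def]
      refine integral_congr_ae ?_
      filter_upwards [haW s, haW t] with ω h3 h4
      rw [h3, h4]
      simp [mul_comm]
    have h3 := hW.covariance_eval (elapsed s) (elapsed t)
    rw [covariance_eq_sub (hG2 s) (hG2 t), hG0, zero_mul, sub_zero] at h3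
    rw [h1, h2, Set.Iic_inter_Iic, lebesgue_real_Iic]
    rw [elapsed_monotone.map_min]
    exact h3
  obtain ⟨z, hzK, hza, hzn⟩ := exists_mem_closure_span_inner_eq a b hab (hh.toLp h)
  have hzH : ∀ t, inner ℝ (a t) z = ∫ s in Set.Iic t, h s ∂lebesgue := by
    intro t
    rw [hza, L2.inner_indicatorConstLp_one]
    exact setIntegral_congr_ae measurableSet_Iic (hh.coeFn_toLp.mono fun x hx _ => hx)
  rw [Lp.norm_toLp] at hzn
  have hz0 : z ≠ 0 := by
    rintro rfl
    obtain ⟨t, ht⟩ := h0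
    exact ht (by rw [← hzH, inner_zero_right])
  have hd : 0 < ‖z‖ := norm_pos_iff.2 hz0
  set ξ : Lp ℝ 2 P := ‖z‖⁻¹ • z with hξ
  have hξK : ξ ∈ (Submodule.span ℝ (Set.range a)).topologicalClosure :=
    Submodule.smul_mem _ _ hzK
  have hξn : ‖ξ‖ = 1 := by
    rw [hξ, norm_smul, norm_inv, norm_norm, inv_mul_cancel₀ hd.ne']
  set u : ObsInterval → ℝ := fun t => inner ℝ (a t) ξ with hu
  have haK : ∀ t, a t ∈ (Submodule.span ℝ (Set.range a)).topologicalClosure :=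
    fun t => Submodule.le_topologicalClosure _ (Submodule.subset_span ⟨t, rfl⟩)
  have hξm : Measurable ξ := (Lp.stronglyMeasurable ξ).measurable
  have hξlaw : P.map ξ = gaussianReal 0 1 := by
    rw [map_eq_gaussianReal_of_mem_closure_span hG hG0 a haW hξK]
    congr 1
    ext
    simp [hξn]
  have hξ0 : ∫ ω, ξ ω ∂P = 0 := by
    have := integral_map (μ := P) hξm.aemeasurable (f := fun x : ℝ => x)
      aestronglyMeasurable_id
    rw [hξlaw, integral_id_gaussianReal] at this
    exact this.symm
  set R : ObsInterval → Ω → ℝ := fun t ω => W (elapsed t) ω - u t * ξ ω with hR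
  have hRm : ∀ t, Measurable (R t) := fun t => by
    have := hWm (elapsed t)
    fun_prop
  have hRae : ∀ t, (a t - u t • ξ : Lp ℝ 2 P) =ᵐ[P] R t := by
    intro t
    filter_upwards [Lp.coeFn_sub (a t) (u t • ξ), Lp.coeFn_smul (u t) ξ, haW t] with ω h1 h2 h3
    rw [h1, Pi.sub_apply, h2, Pi.smul_apply, h3, smul_eq_mul]
  have hjoint : IsGaussianProcess
      (Sum.elim (fun _ : Unit => (ξ : Ω → ℝ)) R) P := by
    have h1 := isGaussianProcess_of_mem_closure_span hG hG0 a haW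
      (Sum.elim (fun _ : Unit => ξ) (fun t => a t - u t • ξ)) (by
        rintro (_ | t)
        · exact hξK
        · exact Submodule.sub_mem _ (haK t) (Submodule.smul_mem _ _ hξK))
    refine h1.congr ?_
    rintro (_ | t)
    · exact Filter.EventuallyEq.rfl
    · exact hRae t
  have hR2 : ∀ t, MemLp (R t) 2 P := fun t => (hjoint.hasGaussianLaw_eval (Sum.inr t)).memLp_two
  have hcov : ∀ t, cov[ξ, R t; P] = 0 := by
    intro t
    have h1 : ∫ ω, ξ ω * R t ω ∂P = inner ℝ ξ (a t - u t • ξ) := by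
      rw [L2.inner_def]
      refine integral_congr_ae ?_
      filter_upwards [hRae t] with ω hω
      rw [hω]
      simp [mul_comm]
    rw [covariance_eq_sub (Lp.memLp ξ) (hR2 t), hξ0, zero_mul, sub_zero]
    refine h1.trans ?_
    rw [inner_sub_right, real_inner_smul_right, real_inner_self_eq_norm_sq, hξn,
      real_inner_comm]
    simp [hu]
  have hind := hjoint.indepFun_of_covariance_eq_zero (fun _ => hξm.aemeasurable)
    (fun t => (hRm t).aemeasurable) (fun _ t => hcov t)
  refine ⟨ξ, fun ω t => R t ω, u, ‖z‖, hξm, measurable_pi_lambda _ hRm, hξlaw, ?_, ?_, ?_,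
    hd.le, hzn⟩
  · exact hind.comp (φ := fun x : Unit → ℝ => x ()) (ψ := id) (measurable_pi_apply _) measurable_id
  · intro ω t
    simp [hR]
  · intro t
    rw [← hzH]
    simp only [hu, hξ, real_inner_smul_right]
    field_simp

/-- The density of the law of the path under drift `g` with respect to its law under drift `f`
has second moment at most `exp (n ‖g - f‖₂²)`; this is the Cauchy–Schwarz form of that fact. -/
lemma lintegral_observedPath_le {Ω : Type*} [MeasurableSpace Ω] {P : Measure Ω}
    {W : ℝ≥0 → Ω → ℝ} (hWm : ∀ t, Measurable (W t)) (hW : IsBrownianReal W P) {n : ℕ} (hn : 0 < n)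
    {f g : ObsInterval → ℝ} (hf : MemLp f 2 lebesgue) (hg : MemLp g 2 lebesgue) {δ : ℝ}
    (hδ0 : 0 ≤ δ) (hδ : eLpNorm (g - f) 2 lebesgue ≤ ENNReal.ofReal δ)
    {φ : (ObsInterval → ℝ) → ℝ≥0∞} (hφ : Measurable φ) :
    ∫⁻ ω, φ (observedPath W n g ω) ∂P ≤
      ENNReal.ofReal (Real.exp (n * δ ^ 2 / 2)) *
        (∫⁻ ω, φ (observedPath W n f ω) ^ 2 ∂P) ^ (1 / 2 : ℝ) := by
  have hP := hW.isGaussianProcess.isProbabilityMeasure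
  have hint : ∀ t : ObsInterval, ∫ s in Set.Iic t, g s ∂lebesgue =
      (∫ s in Set.Iic t, f s ∂lebesgue) + ∫ s in Set.Iic t, (g - f) s ∂lebesgue := by
    intro t
    have h1 : ∫ s in Set.Iic t, (g - f) s ∂lebesgue =
        (∫ s in Set.Iic t, g s ∂lebesgue) - ∫ s in Set.Iic t, f s ∂lebesgue :=
      integral_sub (hg.integrable one_le_two).integrableOn (hf.integrable one_le_two).integrableOn
    rw [h1, add_sub_cancel]
  by_cases h0 : ∃ t : ObsInterval, ∫ s in Set.Iic t, (g - f) s ∂lebesgue ≠ 0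
  · obtain ⟨ξ, R, u, d, hξm, hRm, hξ, hind, hdec, hu, hd0, hd⟩ :=
      exists_gaussian_coordinate hWm hW (g - f) (hg.sub hf) h0
    have hdδ : d ≤ δ := hd.trans (ENNReal.toReal_le_of_le_ofReal hδ0 hδ)
    have hn' : (0 : ℝ) < √n := Real.sqrt_pos.2 (by exact_mod_cast hn)
    set Ψ : ℝ × (ObsInterval → ℝ) → ObsInterval → ℝ := fun p t =>
      (∫ s in Set.Iic t, f s ∂lebesgue) + (1 / √(n : ℝ)) * (p.2 t + u t * p.1) with hΨ
    have hΨm : Measurable Ψ := measurable_pi_lambda _ fun t => by fun_prop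
    have hYf : ∀ ω, observedPath W n f ω = Ψ (ξ ω, R ω) := by
      intro ω
      ext t
      simp only [observedPath, hΨ, hdec]
    have hYg : ∀ ω, observedPath W n g ω = Ψ (ξ ω + √n * d, R ω) := by
      intro ω
      ext t
      simp only [observedPath, hΨ, hdec, hint, hu]
      field_simp
      ring
    have := Measure.isProbabilityMeasure_map (μ := P) hRm.aemeasurable
    have hmap : P.map (fun ω => (ξ ω, R ω)) = (gaussianReal 0 1).prod (P.map R) := by
      rw [← hξ]
      exact (indepFun_iff_map_prod_eq_prod_map_map hξm.aemeasurable hRm.aemeasurable).1 hind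
    have hkey := lintegral_gaussianReal_prod_add_le (P.map R) (√n * d) (fun p => φ (Ψ p))
      (hφ.comp hΨm)
    rw [← hmap, lintegral_map (by fun_prop) (by fun_prop),
      lintegral_map (by fun_prop) (by fun_prop)] at hkey
    simp only [hYf, hYg]
    refine hkey.trans ?_
    gcongr
    rw [mul_pow, Real.sq_sqrt (Nat.cast_nonneg n)]
    gcongr
  · -- the two drifts have the same primitive, so the two observed paths coincide
    push Not at h0
    have hY : observedPath W n g = observedPath W n f := by
      ext ω t
      simp only [observedPath, hint, h0, add_zero]
    rw [hY]
    refine (lintegral_le_lintegral_sq_rpow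
      (hφ.comp (measurable_observedPath hWm n f)).aemeasurable).trans ?_
    refine le_mul_of_one_le_left zero_le ?_
    rw [← ENNReal.ofReal_one]
    exact ENNReal.ofReal_le_ofReal (Real.one_le_exp (by positivity))

/-- The constrained risk inequality: a small risk at `f` forces a large risk at `g`, up to the
distance between `f` and `g` in units of the noise. -/
lemma ofReal_abs_sub_le_risk {Ω : Type*} [MeasurableSpace Ω] {P : Measure Ω}
    {W : ℝ≥0 → Ω → ℝ} (hWm : ∀ t, Measurable (W t)) (hW : IsBrownianReal W P) {n : ℕ} (hn : 0 < n)
    {That : (ObsInterval → ℝ) → ℝ} (hT : Measurable That)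
    {f g : ObsInterval → ℝ} (hf : MemLp f 2 lebesgue) (hg : MemLp g 2 lebesgue) {δ : ℝ}
    (hδ0 : 0 ≤ δ) (hδ : eLpNorm (g - f) 2 lebesgue ≤ ENNReal.ofReal δ) (Tf Tg : ℝ) :
    ENNReal.ofReal |Tg - Tf| ≤
      ENNReal.ofReal (Real.exp (n * δ ^ 2 / 2)) * risk P W n That f Tf ^ (1 / 2 : ℝ) +
        risk P W n That g Tg ^ (1 / 2 : ℝ) := by
  have hP := hW.isGaussianProcess.isProbabilityMeasure
  have hYg := measurable_observedPath hWm n g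
  have hsq : ∀ x : ℝ, ENNReal.ofReal |x| ^ 2 = ENNReal.ofReal (x ^ 2) := fun x => by
    rw [← ENNReal.ofReal_pow (abs_nonneg x), sq_abs]
  have h1 := lintegral_observedPath_le hWm hW hn hf hg hδ0 hδ
    (φ := fun y => ENNReal.ofReal |That y - Tf|) (by fun_prop)
  have h2 := lintegral_le_lintegral_sq_rpow (P := P)
    (φ := fun ω => ENNReal.ofReal |That (observedPath W n g ω) - Tg|) (by fun_prop)
  simp only [hsq] at h1 h2
  refine le_trans ?_ (add_le_add h1 h2)
  rw [← lintegral_add_left (by fun_prop)]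
  calc ENNReal.ofReal |Tg - Tf| = ∫⁻ _, ENNReal.ofReal |Tg - Tf| ∂P := by simp
    _ ≤ _ := by
      refine lintegral_mono fun ω => ?_
      rw [← ENNReal.ofReal_add (abs_nonneg _) (abs_nonneg _)]
      refine ENNReal.ofReal_le_ofReal ?_
      rw [abs_sub_comm (That _) Tg, add_comm]
      exact abs_sub_le _ _ _

/-! ### Moduli of continuity and maximum risks -/

section Moduli

variable {D : Submodule ℝ (ObsInterval → ℝ)} {T : D →ₗ[ℝ] ℝ} {F G : Set D}
  {Ω : Type*} [MeasurableSpace Ω] {P : Measure Ω} {W : ℝ≥0 → Ω → ℝ} {n : ℕ}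
  {That : (ObsInterval → ℝ) → ℝ}

lemma risk_le_maxRisk {f : D} (hf : f ∈ F) :
    risk P W n That (f : ObsInterval → ℝ) (T f) ≤ maxRisk P W n That T F :=
  le_iSup₂ (f := fun (f : D) (_ : f ∈ F) => risk P W n That (f : ObsInterval → ℝ) (T f)) f hf

lemma betweenModulus_le (hD : ∀ f ∈ D, MemLp f 2 lebesgue) (hWm : ∀ t, Measurable (W t))
    (hW : IsBrownianReal W P) (hn : 0 < n) (hT : Measurable That) {δ : ℝ} (hδ : 0 ≤ δ) :
    betweenModulus T F G (ENNReal.ofReal δ) ≤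
      ENNReal.ofReal (Real.exp (n * δ ^ 2 / 2)) * maxRisk P W n That T F ^ (1 / 2 : ℝ) +
        maxRisk P W n That T G ^ (1 / 2 : ℝ) := by
  refine iSup₂_le fun f hf => iSup₂_le fun g hg => iSup_le fun hfg => ?_
  refine (ofReal_abs_sub_le_risk hWm hW hn hT (hD f f.2) (hD g g.2) hδ hfg (T f) (T g)).trans ?_
  gcongr
  · exact risk_le_maxRisk hf
  · exact risk_le_maxRisk hg

/-- An estimator without risk on `F` knows `T f` under every drift, since all the laws of the path
are mutually absolutely continuous. -/
lemma betweenModulus_le_of_maxRisk_eq_zero (hD : ∀ f ∈ D, MemLp f 2 lebesgue)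
    (hWm : ∀ t, Measurable (W t)) (hW : IsBrownianReal W P) (hn : 0 < n) (hT : Measurable That)
    (h0 : maxRisk P W n That T F = 0) (ε : ℝ≥0∞) :
    betweenModulus T F G ε ≤ maxRisk P W n That T G ^ (1 / 2 : ℝ) := by
  refine iSup₂_le fun f hf => iSup₂_le fun g hg => iSup_le fun _ => ?_
  have hfin : eLpNorm ((g : ObsInterval → ℝ) - (f : ObsInterval → ℝ)) 2 lebesgue ≠ ∞ :=
    ((hD g g.2).sub (hD f f.2)).2.ne
  have h := ofReal_abs_sub_le_risk hWm hW hn hT (hD f f.2) (hD g g.2) ENNReal.toReal_nonneg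
    (ENNReal.ofReal_toReal hfin).ge (T f) (T g)
  have hf0 : risk P W n That (f : ObsInterval → ℝ) (T f) = 0 :=
    le_antisymm ((risk_le_maxRisk hf).trans_eq h0) zero_le
  rw [hf0, ENNReal.zero_rpow_of_pos (by norm_num), mul_zero, zero_add] at h
  refine h.trans ?_
  gcongr
  exact risk_le_maxRisk hg

lemma logNoiseLevel_ofReal {γ : ℝ} (hγ : 1 ≤ γ) (hn : 0 < n) :
    logNoiseLevel (ENNReal.ofReal γ) n = ENNReal.ofReal √(Real.log γ / n) := by
  have hn' : (0 : ℝ) < n := by exact_mod_cast hn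
  have hlog : 0 ≤ Real.log γ / n := div_nonneg (Real.log_nonneg hγ) hn'.le
  rw [logNoiseLevel, ENNReal.log_ofReal_of_pos (by linarith), EReal.toENNReal_of_ne_top
    (EReal.coe_ne_top _), EReal.toReal_coe, ← ENNReal.ofReal_natCast,
    ← ENNReal.ofReal_div_of_pos hn', ENNReal.ofReal_rpow_of_nonneg hlog (by norm_num),
    Real.sqrt_eq_rpow]

lemma betweenModulus_noiseLevel_le (hD : ∀ f ∈ D, MemLp f 2 lebesgue)
    (hWm : ∀ t, Measurable (W t)) (hW : IsBrownianReal W P) (hn : 0 < n) (hT : Measurable That) :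
    betweenModulus T F G (noiseLevel n) ≤
      ENNReal.ofReal (Real.exp (1 / 2)) * maxRisk P W n That T F ^ (1 / 2 : ℝ) +
        maxRisk P W n That T G ^ (1 / 2 : ℝ) := by
  have hn' : (0 : ℝ) < n := by exact_mod_cast hn
  have h := betweenModulus_le (F := F) (G := G) (T := T) hD hWm hW hn hT
    (δ := 1 / √(n : ℝ)) (by positivity)
  have he : (n : ℝ) * (1 / √(n : ℝ)) ^ 2 / 2 = 1 / 2 := by
    rw [div_pow, Real.sq_sqrt hn'.le]
    field_simp
  rwa [he] at h

/-- At distance `√(ln γ / n)` the exponential factor is `√γ ≤ γ`. -/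
lemma betweenModulus_logNoiseLevel_le (hD : ∀ f ∈ D, MemLp f 2 lebesgue)
    (hWm : ∀ t, Measurable (W t)) (hW : IsBrownianReal W P) (hn : 0 < n) (hT : Measurable That)
    {γ : ℝ≥0∞} (hγ : 1 ≤ γ) (hγt : γ ≠ ∞) :
    betweenModulus T F G (logNoiseLevel γ n) ≤
      γ * maxRisk P W n That T F ^ (1 / 2 : ℝ) + maxRisk P W n That T G ^ (1 / 2 : ℝ) := by
  have hn' : (0 : ℝ) < n := by exact_mod_cast hn
  lift γ to ℝ≥0 using hγt
  have h1 : (1 : ℝ) ≤ γ := by exact_mod_cast hγ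
  have hlog : 0 ≤ Real.log γ := Real.log_nonneg h1
  rw [← ENNReal.ofReal_coe_nnreal, logNoiseLevel_ofReal h1 hn]
  refine (betweenModulus_le hD hWm hW hn hT (Real.sqrt_nonneg _)).trans ?_
  gcongr
  rw [Real.sq_sqrt (by positivity), mul_div_cancel₀ _ hn'.ne']
  calc Real.exp (Real.log γ / 2) ≤ Real.exp (Real.log γ) := Real.exp_le_exp.2 (by linarith)
    _ = γ := Real.exp_log (by linarith)

end Moduli

end WhiteNoise

open WhiteNoise

/-! ### The lower bound over the larger class -/

theorem theorem1 (cstar : ℝ) (hcstar : 0 < cstar) :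
    ∃ c : ℝ, 0 < c ∧
      ∀ (D : Submodule ℝ (WhiteNoise.ObsInterval → ℝ))
        (_hD : ∀ f ∈ D, MemLp f 2 WhiteNoise.lebesgue)
        (T : D →ₗ[ℝ] ℝ) (F₁ F₂ : Set D) (_hF : (F₁ ∩ F₂).Nonempty)
        (ε₀ : ℝ) (_hε₀ : 0 < ε₀)
        (_hmod : ∀ ε : ℝ, 0 < ε → ε ≤ ε₀ →
          WhiteNoise.modulus T F₁ (ENNReal.ofReal ε) ≤
            WhiteNoise.modulus T F₂ (ENNReal.ofReal ε)),
        ∃ N : ℕ, ∀ n : ℕ, N ≤ n →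
          ∀ (Ω : Type*) [MeasurableSpace Ω] (P : Measure Ω) (W : ℝ≥0 → Ω → ℝ)
            (_hWm : ∀ t, Measurable (W t)) (_hW : IsBrownianReal W P)
            (That : (WhiteNoise.ObsInterval → ℝ) → ℝ) (_hThat : Measurable That),
            WhiteNoise.maxRisk P W n That T F₁ ≤
              ENNReal.ofReal (cstar ^ 2) *
                WhiteNoise.modulus T F₁ (WhiteNoise.noiseLevel n) ^ 2 →
            ENNReal.ofReal c *
                (WhiteNoise.betweenModulus T F₁ F₂
                    (WhiteNoise.logNoiseLevel
                      (WhiteNoise.gammaFactor T F₁ F₂ cstar n) n) ^ 2 +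
                  WhiteNoise.modulus T F₂ (WhiteNoise.noiseLevel n) ^ 2) ≤
              WhiteNoise.maxRisk P W n That T F₂ := by
  set e₁ : ℝ≥0∞ := ENNReal.ofReal (Real.exp 1)
  set e₂ : ℝ≥0∞ := ENNReal.ofReal (Real.exp (1 / 2))
  set a : ℝ≥0∞ := ENNReal.ofReal cstar with ha
  have ha0 : a ≠ 0 := (ENNReal.ofReal_pos.2 hcstar).ne'
  -- `ω(1/√n, F₂)`, `ω₊(1/√n, F₁, F₂)` and `ω₊(√(ln γ / n), F₁, F₂)` are at most `A`, `B` and `C`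
  -- times the root of the maximum risk over `F₂`
  set A : ℝ≥0∞ := e₂ + 1 with hA
  set B : ℝ≥0∞ := e₂ * (a * A) + 1 with hB
  set C : ℝ≥0∞ := e₁ * (a * A) + B + 1 with hC
  have hAt : A ≠ ∞ := by finiteness
  have hBt : B ≠ ∞ := by finiteness
  have hCt : C ≠ ∞ := by finiteness
  have hK0 : C ^ 2 + A ^ 2 ≠ 0 := by
    have : A ≠ 0 := by simp [hA]
    simp [this]
  have hKt : C ^ 2 + A ^ 2 ≠ ∞ := by finiteness
  refine ⟨((C ^ 2 + A ^ 2)⁻¹).toReal,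
    ENNReal.toReal_pos (ENNReal.inv_ne_zero.2 hKt) (ENNReal.inv_ne_top.2 hK0), ?_⟩
  intro D hD T F₁ F₂ _ ε₀ hε₀ hmod
  obtain ⟨N, hN⟩ := exists_nat_ge (1 / ε₀ ^ 2)
  refine ⟨N + 1, fun n hnN Ω _ P W hWm hW That hT hrisk => ?_⟩
  have hn : 0 < n := by omega
  have hn' : (0 : ℝ) < n := by exact_mod_cast hn
  set ω₁ := modulus T F₁ (noiseLevel n)
  set ω₂ := modulus T F₂ (noiseLevel n)
  set p := betweenModulus T F₁ F₂ (noiseLevel n)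
  set γ := gammaFactor T F₁ F₂ cstar n
  set s₁ := maxRisk P W n That T F₁ ^ (1 / 2 : ℝ) with hs₁
  set s₂ := maxRisk P W n That T F₂ ^ (1 / 2 : ℝ) with hs₂
  have hω : ω₁ ≤ ω₂ := by
    refine hmod _ (by positivity) ?_
    rw [div_le_iff₀ (Real.sqrt_pos.2 hn'), ← div_le_iff₀' hε₀]
    refine Real.le_sqrt_of_sq_le ?_
    rw [div_pow, one_pow]
    exact hN.trans (by exact_mod_cast (by omega : N ≤ n))
  have hs₁ω : s₁ ≤ a * ω₁ := by
    have h1 : ENNReal.ofReal (cstar ^ 2) * ω₁ ^ 2 = (a * ω₁) ^ (2 : ℝ) := by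
      rw [ENNReal.rpow_two, mul_pow, ha, ENNReal.ofReal_pow hcstar.le]
    rw [hs₁, one_div]
    exact ENNReal.rpow_inv_le_iff two_pos |>.2 (hrisk.trans_eq h1)
  have hω₂ : ω₂ ≤ A * s₂ := by
    rw [hA, add_mul, one_mul]
    exact betweenModulus_noiseLevel_le hD hWm hW hn hT
  have haω : a * ω₁ ≤ a * A * s₂ := by
    rw [mul_assoc]
    gcongr
    exact hω.trans hω₂
  have hpB : p ≤ B * s₂ :=
    calc p ≤ e₂ * s₁ + s₂ := betweenModulus_noiseLevel_le hD hWm hW hn hT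
      _ ≤ e₂ * (a * A * s₂) + s₂ := by
        gcongr
        exact hs₁ω.trans haω
      _ = B * s₂ := by rw [hB]; ring
  have hCω : betweenModulus T F₁ F₂ (logNoiseLevel γ n) ≤ C * s₂ := by
    have hγ1 : 1 ≤ γ := by
      refine le_trans ?_ (le_max_left _ _)
      rw [← ENNReal.ofReal_one]
      exact ENNReal.ofReal_le_ofReal (Real.one_le_exp zero_le_one)
    by_cases hγt : γ = ∞
    · have hdiv : p / (a * ω₁) = ∞ := by
        rcases max_eq_top.1 hγt with h | h
        · exact absurd h ENNReal.ofReal_ne_top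
        · exact h
      rcases ENNReal.div_eq_top.1 hdiv with ⟨-, h0⟩ | ⟨hpt, -⟩
      · have hs0 : s₁ = 0 := le_antisymm (hs₁ω.trans_eq h0) zero_le
        have hr0 : maxRisk P W n That T F₁ = 0 :=
          (ENNReal.rpow_eq_zero_iff_of_pos (by norm_num)).1 hs0
        refine (betweenModulus_le_of_maxRisk_eq_zero hD hWm hW hn hT hr0 _).trans ?_
        refine le_mul_of_one_le_left zero_le ?_
        rw [hC]
        exact le_add_self
      · have hst : s₂ = ∞ := by
          by_contra h
          exact absurd (top_le_iff.1 (hpt ▸ hpB)) (ENNReal.mul_ne_top hBt h)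
        have hC0 : C ≠ 0 := by simp [hC]
        rw [hst, ENNReal.mul_top hC0]
        exact le_top
    · have hγω : γ * (a * ω₁) ≤ e₁ * (a * ω₁) + p :=
        calc γ * (a * ω₁) ≤ (e₁ + p / (a * ω₁)) * (a * ω₁) := by
              gcongr
              exact max_le le_self_add le_add_self
          _ ≤ e₁ * (a * ω₁) + p := by
              rw [add_mul]
              gcongr
              rw [mul_comm]
              exact ENNReal.mul_div_le
      calc betweenModulus T F₁ F₂ (logNoiseLevel γ n) ≤ γ * s₁ + s₂ :=
            betweenModulus_logNoiseLevel_le hD hWm hW hn hT hγ1 hγt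
        _ ≤ (e₁ * (a * ω₁) + p) + s₂ := by
            gcongr
            exact (by gcongr : γ * s₁ ≤ γ * (a * ω₁)).trans hγω
        _ ≤ (e₁ * (a * A * s₂) + B * s₂) + s₂ := by gcongr
        _ = C * s₂ := by rw [hC]; ring
  have hs₂sq : s₂ ^ 2 = maxRisk P W n That T F₂ := by
    rw [hs₂, ← ENNReal.rpow_two, ← ENNReal.rpow_mul]
    norm_num
  rw [ENNReal.ofReal_toReal (ENNReal.inv_ne_top.2 hK0), ← hs₂sq]
  calc (C ^ 2 + A ^ 2)⁻¹ * (betweenModulus T F₁ F₂ (logNoiseLevel γ n) ^ 2 + ω₂ ^ 2)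
      ≤ (C ^ 2 + A ^ 2)⁻¹ * ((C * s₂) ^ 2 + (A * s₂) ^ 2) := by gcongr
    _ = ((C ^ 2 + A ^ 2)⁻¹ * (C ^ 2 + A ^ 2)) * s₂ ^ 2 := by ring
    _ = s₂ ^ 2 := by rw [ENNReal.inv_mul_cancel hK0 hKt, one_mul]
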